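/- Let $k$ be a field, $n\ge 1$, and $S=k[x_1,\dots,x_n]$ with the standard grading. Order the monomials of $S$ lexicographically with $x_1>x_2>\dots>x_n$. For a squarefree monomial $a$ write $\operatorname{supp}(a)=\{i : x_i\mid a\}$, and let $\mathrm{Mon}^s_q(S)$ denote the set of squarefree monomials of degree $q$ in $S$. For $u,v\in \mathrm{Mon}^s_q(S)$ put $$L(u,v)=\{a\in \mathrm{Mon}^s_q(S) : u\ge_{lex} a\ge_{lex} v\},\quad L^i(v)=\{a\in \mathrm{Mon}^s_q(S) : a\ge_{lex} v\},\quad L^f(u)=\{a\in \mathrm{Mon}^s_q(S) : u\ge_{lex} a\}.$$ A homogeneous ideal $I\subset S$ has an $e$-linear resolution if it has a graded free resolution of the form $\cdots\to S(-e-2)^{b_2}\to S(-e-1)^{b_1}\to S(-e)^{b_0}\to I\to 0$ with all $b_i$ finite (such a resolution is automatically minimal), and $I$ is generated in degree $e$ if it is generated by homogeneous polynomials of degree $e$. Let $w,m\in \mathrm{Mon}^s_d(S)$ with $x_1\mid w$ and $x_1\nmid m$, and let $J=(L^i(w))$ and $K=(L^f(m))$ be the ideals of $S$ generated by $L^i(w)$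 and $L^f(m)$. Then: 1. $J+K$ has a $d$-linear resolution if and only if $J\cap K$ has a $(d+1)$-linear resolution. 2. The set $[n]\setminus\operatorname{supp}(w)$ is nonempty, where $[n]=\{1,\dots,n\}$, and $J\cap K$ is generated in degree $d+1$ if and only if $$J\cap K=\bigl(L(x_1m,\; w\,x_{\max([n]\setminus\operatorname{supp}(w))})\bigr).$$ -/

import Mathlib

/-!
Monomials of `S = k[x_1, …, x_n]` are represented by their exponent vectors in `Fin n →₀ ℕ`; the
variable `x_i` is `X (i - 1)`, so `x_1` has index `0`. The order on `Lex (Fin n →₀ ℕ)` is the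
lexicographic order with `x_1 > x_2 > ⋯ > x_n`.
-/

namespace SquarefreeLex

open MvPolynomial

/-- The set `Mon^s_d(S)` of squarefree monomials of degree `d` in `n` variables. -/
def sqfreeMon (n d : ℕ) : Set (Fin n →₀ ℕ) :=
  {a | (∀ i, a i ≤ 1) ∧ a.degree = d}

/-- The squarefree lexsegment set `L(u, v) = {a ∈ Mon^s_d(S) : u ≥ a ≥ v}` of degree `d`. -/
def lexSegment {n : ℕ} (d : ℕ) (u v : Fin n →₀ ℕ) : Set (Fin n →₀ ℕ) :=
  {a | a ∈ sqfreeMon n d ∧ toLex a ≤ toLex u ∧ toLex v ≤ toLex a}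

/-- The initial squarefree lexsegment set `L^i(v) = {a ∈ Mon^s_d(S) : a ≥ v}` of degree `d`. -/
def initialSegment {n : ℕ} (d : ℕ) (v : Fin n →₀ ℕ) : Set (Fin n →₀ ℕ) :=
  {a | a ∈ sqfreeMon n d ∧ toLex v ≤ toLex a}

/-- The final squarefree lexsegment set `L^f(u) = {a ∈ Mon^s_d(S) : u ≥ a}` of degree `d`. -/
def finalSegment {n : ℕ} (d : ℕ) (u : Fin n →₀ ℕ) : Set (Fin n →₀ ℕ) :=
  {a | a ∈ sqfreeMon n d ∧ toLex a ≤ toLex u}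

/-- The ideal of `k[x_1, …, x_n]` generated by a set of monomials. -/
noncomputable def monomialIdeal (k : Type*) [Field k] {n : ℕ} (A : Set (Fin n →₀ ℕ)) :
    Ideal (MvPolynomial (Fin n) k) :=
  Ideal.span ((fun a => monomial a (1 : k)) '' A)

/-- The ideal `I` is generated by homogeneous polynomials of degree `e`. -/
def GeneratedInDegree {k : Type*} [Field k] {n : ℕ} (I : Ideal (MvPolynomial (Fin n) k))
    (e : ℕ) : Prop :=
  ∃ G : Set (MvPolynomial (Fin n) k), (∀ f ∈ G, f.IsHomogeneous e) ∧ Ideal.span G = I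

/-- `I` has an `e`-linear resolution: there is an exact sequence of graded `S`-modules with maps of
degree `0`
`⋯ → S(-e-2)^{b 2} → S(-e-1)^{b 1} → S(-e)^{b 0} → I → 0`.
A map `ε : S^{b 0} → S` has degree `0` with respect to these shifts if and only if it sends the
standard basis to homogeneous polynomials of degree `e`, and `δ i : S^{b (i+1)} → S^{b i}` does if
and only if the entries of its matrix are linear forms (possibly zero). Since these entries have no
constant term, such a resolution is automatically the minimal graded free resolution of `I`. -/
def HasLinearResolution {k : Type*} [Field k] {n : ℕ} (I : Ideal (MvPolynomial (Fin n) k))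
    (e : ℕ) : Prop :=
  ∃ (b : ℕ → ℕ)
    (ε : (Fin (b 0) → MvPolynomial (Fin n) k) →ₗ[MvPolynomial (Fin n) k] MvPolynomial (Fin n) k)
    (δ : ∀ i : ℕ, (Fin (b (i + 1)) → MvPolynomial (Fin n) k) →ₗ[MvPolynomial (Fin n) k]
      (Fin (b i) → MvPolynomial (Fin n) k)),
    (∀ c, (ε (Pi.single c 1)).IsHomogeneous e) ∧
    (∀ i c r, (δ i (Pi.single c 1) r).IsHomogeneous 1) ∧
    LinearMap.range ε = I ∧
    Function.Exact (δ 0) ε ∧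
    ∀ i, Function.Exact (δ (i + 1)) (δ i)

end SquarefreeLex

/-!
Linearity of a resolution is a condition on successive syzygies: the module is generated in a single
degree, and its syzygies are again linear. If `J` and `K` have `d`-linear resolutions with first
terms `F` and `G`, the kernel of `F ⊕ G → J + K` is filtered with pieces the syzygies of `J`, the
syzygies of `K` and `J ⊓ K`. Since linearity passes to extensions, `J + K` inherits it from `J ⊓ K`.
It also passes to quotients by linear submodules generated in the same degree, and as `J ⊓ K`
vanishes in degree `d`, the presentation `F ⊕ G → J + K` is minimal, so that conversely `J ⊓ K`
inherits linearity from `J + K`.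

Initial and final lexsegment ideals have linear quotients, hence linear resolutions. A monomial of
`J ⊓ K` is divisible by `x_1` and by a monomial of `L^f(m)`, which `x_1` does not divide. Hence
`J ⊓ K` vanishes in degree `d`, and its monomials of degree `d + 1` are exactly those of
`L(x_1 m, w x_M)`, where `M` is the largest index outside `supp w`.
-/

namespace SquarefreeLex

section Graded

variable {S σ : Type*} [CommRing S] [SetLike σ S] {ι κ μ : Type*}

theorem apply_eq_sum_mul_apply_single [Fintype ι] [DecidableEq ι] (f : (ι → S) →ₗ[S] (κ → S))
    (v : ι → S) (r : κ) : f v r = ∑ c, v c * f (Pi.single c 1) r := by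
  conv_lhs => rw [pi_eq_sum_univ' v]
  simp only [map_sum, map_smul, Finset.sum_apply, Pi.smul_apply, smul_eq_mul]

/-- A vector over an `ℕ`-graded ring is homogeneous of degree `a` if all its entries are. -/
def IsHomogeneousVector (𝒜 : ℕ → σ) (a : ℕ) (v : ι → S) : Prop :=
  ∀ i, v i ∈ 𝒜 a

/-- A linear map between free modules over an `ℕ`-graded ring is homogeneous of degree `e` if it
raises the degrees of homogeneous vectors by `e`. -/
def IsHomogeneousMap (𝒜 : ℕ → σ) (f : (ι → S) →ₗ[S] (κ → S)) (e : ℕ) : Prop :=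
  ∀ a v, IsHomogeneousVector 𝒜 a v → IsHomogeneousVector 𝒜 (a + e) (f v)

/-- A submodule of a free module over an `ℕ`-graded ring vanishes in degree `a` if it has no nonzero
homogeneous element of degree `a`. -/
def VanishesInDegree (𝒜 : ℕ → σ) (N : Submodule S (ι → S)) (a : ℕ) : Prop :=
  ∀ v ∈ N, IsHomogeneousVector 𝒜 a v → v = 0

variable {𝒜 : ℕ → σ}

namespace IsHomogeneousMap

theorem id : IsHomogeneousMap 𝒜 (LinearMap.id : (ι → S) →ₗ[S] (ι → S)) 0 :=
  fun _ _ hv => hv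

theorem funLeft (f : κ → ι) : IsHomogeneousMap 𝒜 (LinearMap.funLeft S S f) 0 :=
  fun _ _ hv r => hv (f r)

theorem comp {f : (ι → S) →ₗ[S] (κ → S)} {g : (κ → S) →ₗ[S] (μ → S)} {e t : ℕ}
    (hg : IsHomogeneousMap 𝒜 g t) (hf : IsHomogeneousMap 𝒜 f e) :
    IsHomogeneousMap 𝒜 (g ∘ₗ f) (e + t) := fun a v hv => by
  rw [← add_assoc]
  exact hg _ _ (hf a v hv)

variable [AddSubgroupClass σ S] {f g : (ι → S) →ₗ[S] (κ → S)} {e : ℕ}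

theorem sub (hf : IsHomogeneousMap 𝒜 f e) (hg : IsHomogeneousMap 𝒜 g e) :
    IsHomogeneousMap 𝒜 (f - g) e :=
  fun a v hv r => sub_mem (hf a v hv r) (hg a v hv r)

end IsHomogeneousMap

variable [AddSubgroupClass σ S] [GradedRing 𝒜]

theorem isHomogeneousVector_single_one [DecidableEq ι] (c : ι) :
    IsHomogeneousVector 𝒜 0 (Pi.single c (1 : S)) := by
  intro i
  obtain rfl | hi := eq_or_ne i c
  · rw [Pi.single_eq_same]
    exact SetLike.one_mem_graded 𝒜
  · rw [Pi.single_eq_of_ne hi]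
    exact zero_mem _

theorem isHomogeneousMap_iff [Finite ι] [DecidableEq ι] {f : (ι → S) →ₗ[S] (κ → S)} {e : ℕ} :
    IsHomogeneousMap 𝒜 f e ↔ ∀ c, IsHomogeneousVector 𝒜 e (f (Pi.single c 1)) := by
  cases nonempty_fintype ι
  refine ⟨fun hf c => by simpa only [zero_add] using hf 0 _ (isHomogeneousVector_single_one c),
    fun hf a v hv r => ?_⟩
  rw [apply_eq_sum_mul_apply_single]
  exact sum_mem fun c _ => SetLike.mul_mem_graded (hv c) (hf c r)

variable (𝒜) in
/-- The homogeneous component of degree `a` of a vector over an `ℕ`-graded ring. -/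
def vectorComponent (a : ℕ) (v : ι → S) : ι → S :=
  fun i => GradedRing.proj 𝒜 a (v i)

variable (𝒜) in
/-- A submodule of a free module over an `ℕ`-graded ring is homogeneous if it contains the
homogeneous components of its elements. -/
def IsHomogeneousSubmodule (N : Submodule S (ι → S)) : Prop :=
  ∀ a, ∀ v ∈ N, vectorComponent 𝒜 a v ∈ N

theorem isHomogeneousVector_vectorComponent (a : ℕ) (v : ι → S) :
    IsHomogeneousVector 𝒜 a (vectorComponent 𝒜 a v) :=
  fun _ => SetLike.coe_mem _

theorem IsHomogeneousVector.vectorComponent_eq {a : ℕ} {v : ι → S}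
    (hv : IsHomogeneousVector 𝒜 a v) : vectorComponent 𝒜 a v = v :=
  funext fun i => DirectSum.decompose_of_mem_same 𝒜 (hv i)

namespace IsHomogeneousMap

variable [Finite ι] {f : (ι → S) →ₗ[S] (κ → S)} {e : ℕ}

theorem vectorComponent_apply (hf : IsHomogeneousMap 𝒜 f e) (a : ℕ) (v : ι → S) :
    vectorComponent 𝒜 (a + e) (f v) = f (vectorComponent 𝒜 a v) := by
  classical
  cases nonempty_fintype ι
  ext r
  rw [vectorComponent, apply_eq_sum_mul_apply_single, apply_eq_sum_mul_apply_single, map_sum]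
  exact Finset.sum_congr rfl fun c _ =>
    DirectSum.coe_decompose_mul_add_of_right_mem 𝒜 (isHomogeneousMap_iff.1 hf c r)

theorem vectorComponent_apply_of_lt (hf : IsHomogeneousMap 𝒜 f e) {a : ℕ} (ha : a < e)
    (v : ι → S) : vectorComponent 𝒜 a (f v) = 0 := by
  classical
  cases nonempty_fintype ι
  ext r
  rw [vectorComponent, apply_eq_sum_mul_apply_single, map_sum]
  exact Finset.sum_eq_zero fun c _ => DirectSum.coe_decompose_mul_of_right_mem_of_not_le 𝒜
    (isHomogeneousMap_iff.1 hf c r) ha.not_ge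

theorem isHomogeneousSubmodule_range (hf : IsHomogeneousMap 𝒜 f e) :
    IsHomogeneousSubmodule 𝒜 (LinearMap.range f) := by
  rintro a _ ⟨v, rfl⟩
  obtain ha | ha := lt_or_ge a e
  · rw [hf.vectorComponent_apply_of_lt ha]
    exact zero_mem _
  · obtain ⟨b, rfl⟩ := Nat.exists_eq_add_of_le' ha
    rw [hf.vectorComponent_apply]
    exact LinearMap.mem_range_self _ _

theorem isHomogeneousSubmodule_comap (hf : IsHomogeneousMap 𝒜 f e) {N : Submodule S (κ → S)}
    (hN : IsHomogeneousSubmodule 𝒜 N) : IsHomogeneousSubmodule 𝒜 (N.comap f) := by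
  intro a v hv
  rw [Submodule.mem_comap, ← hf.vectorComponent_apply]
  exact hN _ _ hv

theorem isHomogeneousSubmodule_ker (hf : IsHomogeneousMap 𝒜 f e) :
    IsHomogeneousSubmodule 𝒜 (LinearMap.ker f) :=
  hf.isHomogeneousSubmodule_comap <| by
    rintro a _ rfl
    exact funext fun _ => map_zero (GradedRing.proj 𝒜 a)

theorem vanishesInDegree_range (hf : IsHomogeneousMap 𝒜 f e) {a : ℕ} (ha : a < e) :
    VanishesInDegree 𝒜 (LinearMap.range f) a := by
  rintro _ ⟨v, rfl⟩ hv
  rw [← hv.vectorComponent_eq, hf.vectorComponent_apply_of_lt ha]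

/-- Lift the images of the standard basis, and keep only the components of the right degree. -/
theorem exists_lift [Finite μ] {g : (ι → S) →ₗ[S] (κ → S)} {t : ℕ}
    (hg : IsHomogeneousMap 𝒜 g t) {B : Submodule S (ι → S)} (hB : IsHomogeneousSubmodule 𝒜 B)
    {γ : (μ → S) →ₗ[S] (κ → S)} (hγ : IsHomogeneousMap 𝒜 γ (e + t))
    (h : LinearMap.range γ ≤ B.map g) :
    ∃ β : (μ → S) →ₗ[S] (ι → S), IsHomogeneousMap 𝒜 β e ∧ LinearMap.range β ≤ B ∧ g ∘ₗ β = γ := by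
  classical
  cases nonempty_fintype μ
  choose y hyB hy using fun c => h (LinearMap.mem_range_self γ (Pi.single c 1))
  have hgy (c : μ) : g (vectorComponent 𝒜 e (y c)) = γ (Pi.single c 1) := by
    rw [← hg.vectorComponent_apply, hy, (isHomogeneousMap_iff.1 hγ c).vectorComponent_eq]
  refine ⟨Fintype.linearCombination S fun c => vectorComponent 𝒜 e (y c),
    isHomogeneousMap_iff.2 fun c => ?_, ?_, LinearMap.pi_ext' fun c => LinearMap.ext_ring ?_⟩
  · rw [Fintype.linearCombination_apply_single, one_smul]
    exact isHomogeneousVector_vectorComponent e (y c)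
  · rw [Fintype.range_linearCombination, Submodule.span_le]
    rintro _ ⟨c, rfl⟩
    exact hB e _ (hyB c)
  · simp [hgy]

end IsHomogeneousMap

end Graded

section BlockMaps

variable {S M : Type*} [CommRing S] [AddCommGroup M] [Module S M] {κ μ : Type*}

/-- The map `(v, v') ↦ α v + β v'` on the free module `S ^ (κ ⊕ μ) = S ^ κ × S ^ μ`. -/
def sumCoprod (α : (κ → S) →ₗ[S] M) (β : (μ → S) →ₗ[S] M) : (κ ⊕ μ → S) →ₗ[S] M :=
  α ∘ₗ LinearMap.funLeft S S Sum.inl + β ∘ₗ LinearMap.funLeft S S Sum.inr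

variable (S κ μ) in
/-- The inclusion `v ↦ (v, 0)` of `S ^ κ` into `S ^ (κ ⊕ μ) = S ^ κ × S ^ μ`. -/
def sumInl : (κ → S) →ₗ[S] (κ ⊕ μ → S) :=
  (LinearEquiv.sumArrowLequivProdArrow κ μ S S).symm.toLinearMap ∘ₗ LinearMap.inl S _ _

theorem ker_sumInl : LinearMap.ker (sumInl S κ μ) = ⊥ :=
  LinearMap.ker_eq_bot.2
    ((LinearEquiv.sumArrowLequivProdArrow κ μ S S).symm.injective.comp LinearMap.inl_injective)

variable {α : (κ → S) →ₗ[S] M} {β : (μ → S) →ₗ[S] M}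

theorem sumCoprod_eq_coprod_comp : sumCoprod α β =
    α.coprod β ∘ₗ (LinearEquiv.sumArrowLequivProdArrow κ μ S S).toLinearMap :=
  rfl

theorem range_sumCoprod :
    LinearMap.range (sumCoprod α β) = LinearMap.range α ⊔ LinearMap.range β := by
  rw [sumCoprod_eq_coprod_comp, LinearEquiv.range_comp, LinearMap.range_coprod]

theorem ker_sumCoprod_inf_ker_snd :
    LinearMap.ker (sumCoprod α β) ⊓ LinearMap.ker (LinearMap.funLeft S S Sum.inr) =
      (LinearMap.ker α).map (sumInl S κ μ) := by
  ext z
  constructor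
  · rintro ⟨hz, hz' : LinearMap.funLeft S S Sum.inr z = 0⟩
    refine ⟨LinearMap.funLeft S S Sum.inl z, ?_, ?_⟩
    · simpa [sumCoprod, hz'] using hz
    · ext (i | j)
      exacts [rfl, (congrFun hz' j).symm]
  · rintro ⟨v, hv : α v = 0, rfl⟩
    refine ⟨?_, rfl⟩
    change α v + β 0 = 0
    rw [hv, map_zero, zero_add]

theorem map_snd_ker_sumCoprod :
    (LinearMap.ker (sumCoprod α β)).map (LinearMap.funLeft S S Sum.inr) =
      (LinearMap.range α).comap β := by
  ext v
  constructor
  · rintro ⟨z, hz, rfl⟩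
    exact ⟨-LinearMap.funLeft S S Sum.inl z, by rw [map_neg]; exact neg_eq_of_add_eq_zero_right hz⟩
  · rintro ⟨u, hu⟩
    exact ⟨Sum.elim (-u) v, by
      change α (-u) + β v = 0
      rw [map_neg, hu, neg_add_cancel], rfl⟩

end BlockMaps

section Linear

variable {S σ : Type*} [CommRing S] [SetLike σ S] {ι κ μ : Type}

/-- A submodule of a free module over an `ℕ`-graded ring is `e`-linear if it has an `e`-linear free
resolution. This is encoded coinductively, as the largest predicate `P` for which `P N e` implies
that `N` is generated by finitely many vectors of degree `e` with `P K 1` for the module `K` of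
their syzygies. -/
def IsLinear (𝒜 : ℕ → σ) (N : Submodule S (ι → S)) (e : ℕ) : Prop :=
  ∃ P : ∀ ι : Type, Submodule S (ι → S) → ℕ → Prop,
    (∀ ι N e, P ι N e → ∃ κ : Type, Finite κ ∧ ∃ ε : (κ → S) →ₗ[S] (ι → S),
      IsHomogeneousMap 𝒜 ε e ∧ LinearMap.range ε = N ∧ P κ (LinearMap.ker ε) 1) ∧ P ι N e

variable {𝒜 : ℕ → σ}

theorem IsLinear.exists_presentation {N : Submodule S (ι → S)} {e : ℕ} :
    IsLinear 𝒜 N e → ∃ κ : Type, Finite κ ∧ ∃ ε : (κ → S) →ₗ[S] (ι → S),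
      IsHomogeneousMap 𝒜 ε e ∧ LinearMap.range ε = N ∧ IsLinear 𝒜 (LinearMap.ker ε) 1 := by
  rintro ⟨P, hP, hN⟩
  obtain ⟨κ, hκ, ε, hε, hεN, hεP⟩ := hP ι N e hN
  exact ⟨κ, hκ, ε, hε, hεN, P, hP, hεP⟩

theorem IsHomogeneousMap.isLinear_range [Finite κ] {ε : (κ → S) →ₗ[S] (ι → S)} {e : ℕ}
    (hε : IsHomogeneousMap 𝒜 ε e) (h : IsLinear 𝒜 (LinearMap.ker ε) 1) :
    IsLinear 𝒜 (LinearMap.range ε) e := by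
  refine ⟨fun ι N e => ∃ κ : Type, Finite κ ∧ ∃ ε : (κ → S) →ₗ[S] (ι → S),
    IsHomogeneousMap 𝒜 ε e ∧ LinearMap.range ε = N ∧ IsLinear 𝒜 (LinearMap.ker ε) 1, ?_,
    κ, ‹_›, ε, hε, rfl, h⟩
  rintro ι N e ⟨κ, hκ, ε, hε, hεN, h⟩
  exact ⟨κ, hκ, ε, hε, hεN, h.exists_presentation⟩

theorem IsLinear.map {N : Submodule S (ι → S)} {e t : ℕ} (hN : IsLinear 𝒜 N e)
    {g : (ι → S) →ₗ[S] (μ → S)} (hg : IsHomogeneousMap 𝒜 g t) (hg0 : LinearMap.ker g = ⊥) :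
    IsLinear 𝒜 (N.map g) (e + t) := by
  obtain ⟨κ, _, ε, hε, rfl, h⟩ := hN.exists_presentation
  rw [← LinearMap.range_comp]
  exact (hg.comp hε).isLinear_range (by rwa [LinearMap.ker_comp_of_ker_eq_bot _ hg0])

theorem IsLinear.exists_fin_presentation {N : Submodule S (ι → S)} {e : ℕ} (hN : IsLinear 𝒜 N e) :
    ∃ (b : ℕ) (ε : (Fin b → S) →ₗ[S] (ι → S)),
      IsHomogeneousMap 𝒜 ε e ∧ LinearMap.range ε = N ∧ IsLinear 𝒜 (LinearMap.ker ε) 1 := by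
  obtain ⟨κ, _, ε, hε, rfl, h⟩ := hN.exists_presentation
  let r : (Fin (Nat.card κ) → S) ≃ₗ[S] (κ → S) := LinearEquiv.funCongrLeft S S (Finite.equivFin κ)
  refine ⟨Nat.card κ, ε ∘ₗ r.toLinearMap, ?_, LinearEquiv.range_comp _ _, ?_⟩
  · exact fun a v hv => hε a _ fun i => hv _
  · rw [LinearMap.ker_comp, Submodule.comap_equiv_eq_map_symm]
    exact h.map (t := 0) (g := r.symm.toLinearMap) (fun a v hv i => hv _) r.symm.ker

theorem isLinear_iff_exists_resolution {N : Submodule S (ι → S)} {e : ℕ} :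
    IsLinear 𝒜 N e ↔ ∃ (b : ℕ → ℕ) (ε : (Fin (b 0) → S) →ₗ[S] (ι → S))
      (δ : ∀ i, (Fin (b (i + 1)) → S) →ₗ[S] (Fin (b i) → S)),
      IsHomogeneousMap 𝒜 ε e ∧ (∀ i, IsHomogeneousMap 𝒜 (δ i) 1) ∧ LinearMap.range ε = N ∧
      Function.Exact (δ 0) ε ∧ ∀ i, Function.Exact (δ (i + 1)) (δ i) := by
  constructor
  · intro hN
    obtain ⟨b₀, ε, hε, hεN, hεL⟩ := hN.exists_fin_presentation
    choose next f hf hfrange hfker using fun s : (b : ℕ) × {K : Submodule S (Fin b → S) //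
      IsLinear 𝒜 K 1} => s.2.2.exists_fin_presentation
    let s : ℕ → (b : ℕ) × {K : Submodule S (Fin b → S) // IsLinear 𝒜 K 1} :=
      Nat.rec ⟨b₀, _, hεL⟩ fun _ s => ⟨next s, _, hfker s⟩
    exact ⟨fun i => (s i).1, ε, fun i => f (s i), hε, fun i => hf (s i), hεN,
      LinearMap.exact_iff.2 (hfrange (s 0)).symm,
      fun i => LinearMap.exact_iff.2 (hfrange (s (i + 1))).symm⟩
  · intro h
    refine ⟨fun ι N e => ∃ (b : ℕ → ℕ) (ε : (Fin (b 0) → S) →ₗ[S] (ι → S))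
      (δ : ∀ i, (Fin (b (i + 1)) → S) →ₗ[S] (Fin (b i) → S)),
      IsHomogeneousMap 𝒜 ε e ∧ (∀ i, IsHomogeneousMap 𝒜 (δ i) 1) ∧ LinearMap.range ε = N ∧
      Function.Exact (δ 0) ε ∧ ∀ i, Function.Exact (δ (i + 1)) (δ i), ?_, h⟩
    rintro ι N e ⟨b, ε, δ, hε, hδ, hN, h0, h⟩
    exact ⟨Fin (b 0), inferInstance, ε, hε, hN, fun i => b (i + 1), δ 0, fun i => δ (i + 1), hδ 0,
      fun i => hδ (i + 1), (LinearMap.exact_iff.1 h0).symm, h 0, fun i => h (i + 1)⟩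

variable [AddSubgroupClass σ S]

theorem isHomogeneousMap_sumInl : IsHomogeneousMap 𝒜 (sumInl S κ μ) 0 := by
  rintro a v hv (i | j)
  exacts [hv i, zero_mem _]

theorem IsHomogeneousMap.sumCoprod {α : (κ → S) →ₗ[S] (ι → S)} {β : (μ → S) →ₗ[S] (ι → S)} {e : ℕ}
    (hα : IsHomogeneousMap 𝒜 α e) (hβ : IsHomogeneousMap 𝒜 β e) :
    IsHomogeneousMap 𝒜 (sumCoprod α β) e :=
  fun a _ hv r => add_mem (hα a _ (fun i => hv (Sum.inl i)) r) (hβ a _ (fun i => hv (Sum.inr i)) r)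

theorem isLinear_bot (e : ℕ) : IsLinear 𝒜 (⊥ : Submodule S (ι → S)) e :=
  ⟨fun _ N _ => N = ⊥, fun ι _ _ hN => ⟨Empty, inferInstance, 0,
    fun _ _ _ _ => zero_mem _, by rw [hN, LinearMap.range_zero],
    (Submodule.eq_bot_iff _).2 fun _ _ => Subsingleton.elim _ _⟩, rfl⟩

theorem isLinear_top [Finite ι] : IsLinear 𝒜 (⊤ : Submodule S (ι → S)) 0 := by
  rw [← LinearMap.range_id]
  exact IsHomogeneousMap.id.isLinear_range (by rw [LinearMap.ker_id]; exact isLinear_bot 1)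

variable [GradedRing 𝒜]

theorem IsLinear.isHomogeneousSubmodule {N : Submodule S (ι → S)} {e : ℕ}
    (hN : IsLinear 𝒜 N e) : IsHomogeneousSubmodule 𝒜 N := by
  obtain ⟨κ, _, ε, hε, rfl, -⟩ := hN.exists_presentation
  exact hε.isHomogeneousSubmodule_range

theorem IsLinear.vanishesInDegree {N : Submodule S (ι → S)} {e a : ℕ}
    (hN : IsLinear 𝒜 N e) (ha : a < e) : VanishesInDegree 𝒜 N a := by
  obtain ⟨κ, _, ε, hε, rfl, -⟩ := hN.exists_presentation
  exact hε.vanishesInDegree_range ha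

/-- The horseshoe lemma for the filtration of `B` with pieces `B ⊓ ker g` and `g(B)`. -/
theorem IsHomogeneousMap.exists_horseshoe [Finite ι] [Finite μ] {ν : Type}
    {B : Submodule S (ι → S)} (hB : IsHomogeneousSubmodule 𝒜 B)
    {g : (ι → S) →ₗ[S] (ν → S)} {e t : ℕ} (hg : IsHomogeneousMap 𝒜 g t)
    {α : (κ → S) →ₗ[S] (ι → S)} (hα : IsHomogeneousMap 𝒜 α e)
    (hαB : LinearMap.range α = B ⊓ LinearMap.ker g)
    {γ : (μ → S) →ₗ[S] (ν → S)} (hγ : IsHomogeneousMap 𝒜 γ (e + t))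
    (hγB : LinearMap.range γ = B.map g) :
    ∃ ε : (κ ⊕ μ → S) →ₗ[S] (ι → S), IsHomogeneousMap 𝒜 ε e ∧ LinearMap.range ε = B ∧
      LinearMap.ker ε ⊓ LinearMap.ker (LinearMap.funLeft S S Sum.inr) =
        (LinearMap.ker α).map (sumInl S κ μ) ∧
      (LinearMap.ker ε).map (LinearMap.funLeft S S Sum.inr) = LinearMap.ker γ := by
  obtain ⟨β, hβ, hβB, rfl⟩ := hg.exists_lift hB hγ hγB.le
  refine ⟨_, hα.sumCoprod hβ, ?_, ker_sumCoprod_inf_ker_snd, ?_⟩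
  · rw [range_sumCoprod, hαB]
    refine le_antisymm (sup_le inf_le_left hβB) fun b hb => ?_
    obtain ⟨u, hu : g (β u) = g b⟩ := hγB.ge (Submodule.mem_map_of_mem hb)
    have hβu : β u ∈ B := hβB (LinearMap.mem_range_self β u)
    rw [← sub_add_cancel b (β u)]
    exact Submodule.add_mem_sup ⟨sub_mem hb hβu, by simp [hu]⟩ (LinearMap.mem_range_self β u)
  · rw [map_snd_ker_sumCoprod, hαB, Submodule.comap_inf, LinearMap.ker_comp]
    exact inf_eq_right.2 fun v _ => hβB (LinearMap.mem_range_self β v)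

theorem isLinear_of_isLinear_inf_ker_of_isLinear_map [Finite ι] {B : Submodule S (ι → S)}
    (hB : IsHomogeneousSubmodule 𝒜 B) {g : (ι → S) →ₗ[S] (κ → S)} {e t : ℕ}
    (hg : IsHomogeneousMap 𝒜 g t) (hBg : IsLinear 𝒜 (B ⊓ LinearMap.ker g) e)
    (hgB : IsLinear 𝒜 (B.map g) (e + t)) : IsLinear 𝒜 B e := by
  refine ⟨fun ι B e => Finite ι ∧ IsHomogeneousSubmodule 𝒜 B ∧ ∃ (κ : Type) (t : ℕ)
    (g : (ι → S) →ₗ[S] (κ → S)), IsHomogeneousMap 𝒜 g t ∧ IsLinear 𝒜 (B ⊓ LinearMap.ker g) e ∧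
      IsLinear 𝒜 (B.map g) (e + t), ?_, ‹_›, hB, κ, t, g, hg, hBg, hgB⟩
  rintro ι B e ⟨_, hB, κ, t, g, hg, hBg, hgB⟩
  obtain ⟨μ, _, α, hα, hαB, hαL⟩ := hBg.exists_presentation
  obtain ⟨ν, _, γ, hγ, hγB, hγL⟩ := hgB.exists_presentation
  obtain ⟨ε, hε, hεB, hεα, hεγ⟩ := hg.exists_horseshoe hB hα hαB hγ hγB
  refine ⟨μ ⊕ ν, inferInstance, ε, hε, hεB, inferInstance, hε.isHomogeneousSubmodule_ker, ν, 0, _,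
    IsHomogeneousMap.funLeft Sum.inr, ?_, ?_⟩
  · rw [hεα]
    exact hαL.map isHomogeneousMap_sumInl ker_sumInl
  · rwa [hεγ]

theorem IsHomogeneousMap.eq_id_of_comp_eq [Finite κ] {φ : (κ → S) →ₗ[S] (ι → S)}
    (hφ : VanishesInDegree 𝒜 (LinearMap.ker φ) 0) {h : (κ → S) →ₗ[S] (κ → S)}
    (hh : IsHomogeneousMap 𝒜 h 0) (hφh : φ ∘ₗ h = φ) : h = LinearMap.id := by
  classical
  refine LinearMap.pi_ext' fun c => LinearMap.ext_ring (sub_eq_zero.1 (hφ _ ?_ ?_))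
  · exact LinearMap.sub_mem_ker_iff.2 (LinearMap.congr_fun hφh (Pi.single c 1))
  · exact isHomogeneousMap_iff.1 (hh.sub id) c

/-- A minimal presentation lifts to the first step of a linear resolution and back. As the syzygies
have no nonzero elements of degree zero, the two lifts are mutually inverse. -/
theorem IsLinear.isLinear_ker {N : Submodule S (ι → S)} {e : ℕ} (hN : IsLinear 𝒜 N e) [Finite κ]
    {φ : (κ → S) →ₗ[S] (ι → S)} (hφ : IsHomogeneousMap 𝒜 φ e) (hφN : LinearMap.range φ = N)
    (hφ0 : VanishesInDegree 𝒜 (LinearMap.ker φ) 0) : IsLinear 𝒜 (LinearMap.ker φ) 1 := by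
  obtain ⟨μ, _, ψ, hψ, rfl, hψL⟩ := hN.exists_presentation
  have htop {ν : Type} : IsHomogeneousSubmodule 𝒜 (⊤ : Submodule S (ν → S)) :=
    fun _ _ _ => Submodule.mem_top
  obtain ⟨h, hh, -, hψh⟩ := hψ.exists_lift htop (γ := φ) (by rwa [zero_add])
    (by rw [hφN, Submodule.map_top])
  obtain ⟨h', hh', -, hφh'⟩ := hφ.exists_lift htop (γ := ψ) (by rwa [zero_add])
    (by rw [← hφN, Submodule.map_top])
  have hleft : h ∘ₗ h' = LinearMap.id := (hh.comp hh').eq_id_of_comp_eq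
    (hψL.vanishesInDegree zero_lt_one) (by rw [← LinearMap.comp_assoc, hψh, hφh'])
  have hright : h' ∘ₗ h = LinearMap.id := (hh'.comp hh).eq_id_of_comp_eq hφ0
    (by rw [← LinearMap.comp_assoc, hφh', hψh])
  have hker : LinearMap.ker φ = (LinearMap.ker ψ).map h' := by
    rw [← hφh', LinearMap.ker_comp, Submodule.map_comap_eq_of_surjective
      (LinearMap.surjective_of_comp_eq_id _ _ hright)]
  rw [hker]
  exact hψL.map hh' (LinearMap.ker_eq_bot_of_inverse hleft)

/-- The kernel of `α ⊕ β`, where `α` and `β` present `A` and `B`, is filtered with pieces the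
syzygies of `A`, the syzygies of `B` and `A ⊓ B`. -/
theorem IsLinear.sup [Finite ι] {A B : Submodule S (ι → S)} {e : ℕ} (hA : IsLinear 𝒜 A e)
    (hB : IsLinear 𝒜 B e) (hAB : IsLinear 𝒜 (A ⊓ B) (e + 1)) : IsLinear 𝒜 (A ⊔ B) e := by
  have hAgr := hA.isHomogeneousSubmodule
  obtain ⟨κ, _, α, hα, rfl, hαL⟩ := hA.exists_presentation
  obtain ⟨μ, _, β, hβ, rfl, hβL⟩ := hB.exists_presentation
  have hcomap : IsLinear 𝒜 ((LinearMap.range α).comap β) 1 := by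
    refine isLinear_of_isLinear_inf_ker_of_isLinear_map (hβ.isHomogeneousSubmodule_comap hAgr) hβ
      ?_ ?_
    · rwa [inf_eq_right.2 (LinearMap.ker_le_comap β)]
    · rwa [Submodule.map_comap_eq, inf_comm, add_comm]
  have hαβ : IsHomogeneousMap 𝒜 (sumCoprod α β) e := hα.sumCoprod hβ
  rw [← range_sumCoprod]
  refine hαβ.isLinear_range (isLinear_of_isLinear_inf_ker_of_isLinear_map
    hαβ.isHomogeneousSubmodule_ker (IsHomogeneousMap.funLeft Sum.inr) ?_ ?_)
  · rw [ker_sumCoprod_inf_ker_snd]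
    exact hαL.map isHomogeneousMap_sumInl ker_sumInl
  · rwa [map_snd_ker_sumCoprod]

section ConnectedAlgebra

variable {k : Type*} [Field k] [Algebra k S] {𝒜 : ℕ → Submodule k S} [GradedRing 𝒜]

/-- Choose a maximal `k`-linearly independent subfamily of the generators. -/
theorem IsHomogeneousMap.exists_minimal_presentation (h𝒜 : 𝒜 0 ≤ 1)
    [Finite κ] {φ : (κ → S) →ₗ[S] (ι → S)} {e : ℕ} (hφ : IsHomogeneousMap 𝒜 φ e) :
    ∃ μ : Type, Finite μ ∧ ∃ γ : (μ → S) →ₗ[S] (ι → S), IsHomogeneousMap 𝒜 γ e ∧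
      LinearMap.range γ = LinearMap.range φ ∧ VanishesInDegree 𝒜 (LinearMap.ker γ) 0 := by
  classical
  cases nonempty_fintype κ
  let u : κ → ι → S := fun c => φ (Pi.single c 1)
  have hφu : φ = Fintype.linearCombination S u :=
    LinearMap.pi_ext' fun c => LinearMap.ext_ring (by simp [u])
  obtain ⟨μ, a, ha, hspan, hindep⟩ := exists_linearIndependent' k u
  have := Finite.of_injective a ha
  cases nonempty_fintype μ
  refine ⟨μ, this, Fintype.linearCombination S (u ∘ a), isHomogeneousMap_iff.2 fun c => ?_, ?_, ?_⟩
  · rw [Fintype.linearCombination_apply_single, one_smul]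
    exact isHomogeneousMap_iff.1 hφ (a c)
  · rw [hφu, Fintype.range_linearCombination, Fintype.range_linearCombination,
      ← Submodule.span_span_of_tower k, hspan, Submodule.span_span_of_tower]
  · intro v hv hv0
    choose c hc using fun i => Submodule.mem_one.1 (h𝒜 (hv0 i))
    obtain rfl : (fun i => algebraMap k S (c i)) = v := funext hc
    have hc0 : c = 0 := funext <| Fintype.linearIndependent_iff.1 hindep c <| by
      simpa [Fintype.linearCombination_apply] using hv
    simp [hc0, ← Pi.zero_def]

/-- A minimal presentation of `g(B)` and any presentation of `B ⊓ ker g` in degree `e` combine to a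
minimal presentation of `B`, whose syzygies are therefore linear. -/
theorem IsLinear.map_of_isLinear_inf_ker (h𝒜 : 𝒜 0 ≤ 1) [Finite ι] {B : Submodule S (ι → S)}
    {e t : ℕ} (hB : IsLinear 𝒜 B e) {g : (ι → S) →ₗ[S] (κ → S)} (hg : IsHomogeneousMap 𝒜 g t)
    (hBg : IsLinear 𝒜 (B ⊓ LinearMap.ker g) e) : IsLinear 𝒜 (B.map g) (e + t) := by
  refine ⟨fun κ C d => ∃ ι : Type, Finite ι ∧ ∃ (B : Submodule S (ι → S)) (e : ℕ)
    (g : (ι → S) →ₗ[S] (κ → S)) (t : ℕ), IsLinear 𝒜 B e ∧ IsHomogeneousMap 𝒜 g t ∧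
      IsLinear 𝒜 (B ⊓ LinearMap.ker g) e ∧ B.map g = C ∧ e + t = d, ?_, ι, ‹_›, B, e, g, t,
    hB, hg, hBg, rfl, rfl⟩
  rintro κ _ _ ⟨ι, _, B, e, g, t, hB, hg, hBg, rfl, rfl⟩
  obtain ⟨μ, _, α, hα, hαB, hαL⟩ := hBg.exists_presentation
  obtain ⟨_, _, ψ, hψ, hψB, -⟩ := hB.exists_presentation
  obtain ⟨ν, _, γ, hγ, hγB, hγ0⟩ := (hg.comp hψ).exists_minimal_presentation h𝒜
  rw [LinearMap.range_comp, hψB] at hγB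
  obtain ⟨ε, hε, hεB, hεα, hεγ⟩ := hg.exists_horseshoe hB.isHomogeneousSubmodule hα hαB hγ hγB
  have hεα' : IsLinear 𝒜 (LinearMap.ker ε ⊓ LinearMap.ker (LinearMap.funLeft S S Sum.inr)) 1 := by
    rw [hεα]
    exact hαL.map isHomogeneousMap_sumInl ker_sumInl
  have hε0 : VanishesInDegree 𝒜 (LinearMap.ker ε) 0 := fun v hv hv0 =>
    hεα'.vanishesInDegree zero_lt_one v
      ⟨hv, hγ0 _ (hεγ.le (Submodule.mem_map_of_mem hv)) fun i => hv0 _⟩ hv0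
  exact ⟨ν, ‹_›, γ, hγ, hγB, μ ⊕ ν, inferInstance, LinearMap.ker ε, 1, _, 0,
    hB.isLinear_ker hε hεB hε0, IsHomogeneousMap.funLeft Sum.inr, hεα', hεγ, rfl⟩

theorem IsLinear.inf (h𝒜 : 𝒜 0 ≤ 1) [Finite ι] {A B : Submodule S (ι → S)} {e : ℕ}
    (hA : IsLinear 𝒜 A e) (hB : IsLinear 𝒜 B e) (hAB : IsLinear 𝒜 (A ⊔ B) e)
    (hAB0 : VanishesInDegree 𝒜 (A ⊓ B) e) : IsLinear 𝒜 (A ⊓ B) (e + 1) := by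
  obtain ⟨κ, _, α, hα, rfl, hαL⟩ := hA.exists_presentation
  obtain ⟨μ, _, β, hβ, rfl, hβL⟩ := hB.exists_presentation
  have hinl : IsLinear 𝒜 (LinearMap.ker (sumCoprod α β) ⊓
      LinearMap.ker (LinearMap.funLeft S S Sum.inr)) 1 := by
    rw [ker_sumCoprod_inf_ker_snd]
    exact hαL.map isHomogeneousMap_sumInl ker_sumInl
  have hvanish : VanishesInDegree 𝒜 (LinearMap.ker (sumCoprod α β)) 0 := by
    intro z hz hz0
    have hzβ0 := hβ 0 _ (IsHomogeneousMap.funLeft Sum.inr 0 z hz0)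
    have hβz : β (LinearMap.funLeft S S Sum.inr z) = 0 := hAB0 _
      ⟨map_snd_ker_sumCoprod.le (Submodule.mem_map_of_mem hz), LinearMap.mem_range_self β _⟩
      (by simpa only [zero_add] using hzβ0)
    exact hinl.vanishesInDegree zero_lt_one z
      ⟨hz, hβL.vanishesInDegree zero_lt_one _ hβz fun i => hz0 _⟩ hz0
  have hker : IsLinear 𝒜 (LinearMap.ker (sumCoprod α β)) 1 :=
    hAB.isLinear_ker (hα.sumCoprod hβ) range_sumCoprod hvanish
  have hcomap : IsLinear 𝒜 ((LinearMap.range α).comap β) 1 := by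
    rw [← map_snd_ker_sumCoprod]
    exact hker.map_of_isLinear_inf_ker h𝒜 (IsHomogeneousMap.funLeft Sum.inr) hinl
  rw [inf_comm, ← Submodule.map_comap_eq, add_comm]
  exact hcomap.map_of_isLinear_inf_ker h𝒜 hβ (by rwa [inf_eq_right.2 (LinearMap.ker_le_comap β)])

end ConnectedAlgebra

end Linear

section Ideals

variable {S : Type*} [CommRing S]

/-- Ideals of `S`, viewed as submodules of the free module of rank one. -/
def rankOne : Ideal S ≃o Submodule S (Unit → S) :=
  Submodule.orderIsoMapComap (LinearEquiv.funUnique Unit S S).symm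

theorem mem_rankOne {I : Ideal S} {v : Unit → S} : v ∈ rankOne I ↔ v () ∈ I :=
  Submodule.mem_map_equiv _

open MvPolynomial

attribute [local instance] MvPolynomial.gradedAlgebra

variable {k : Type*} [Field k] {n : ℕ} {I A B : Ideal (MvPolynomial (Fin n) k)} {e : ℕ}

theorem hasLinearResolution_iff_isLinear :
    HasLinearResolution I e ↔ IsLinear (homogeneousSubmodule (Fin n) k) (rankOne I) e := by
  rw [isLinear_iff_exists_resolution]
  let u := LinearEquiv.funUnique Unit (MvPolynomial (Fin n) k) (MvPolynomial (Fin n) k)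
  constructor
  · rintro ⟨b, ε, δ, hε, hδ, rfl, h0, h⟩
    refine ⟨b, u.symm.toLinearMap ∘ₗ ε, δ, isHomogeneousMap_iff.2 fun c _ => hε c,
      fun i => isHomogeneousMap_iff.2 (hδ i), LinearMap.range_comp _ _, ?_, h⟩
    rwa [LinearMap.exact_iff, LinearEquiv.ker_comp, ← LinearMap.exact_iff]
  · rintro ⟨b, ε, δ, hε, hδ, hI, h0, h⟩
    refine ⟨b, u.toLinearMap ∘ₗ ε, δ, fun c => isHomogeneousMap_iff.1 hε c (),
      fun i => isHomogeneousMap_iff.1 (hδ i), ?_, ?_, h⟩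
    · rw [LinearMap.range_comp, hI]
      exact (Submodule.map_equiv_eq_comap_symm u _).trans (rankOne.symm_apply_apply I)
    · rwa [LinearMap.exact_iff, LinearEquiv.ker_comp, ← LinearMap.exact_iff]

theorem hasLinearResolution_bot (e : ℕ) :
    HasLinearResolution (⊥ : Ideal (MvPolynomial (Fin n) k)) e := by
  rw [hasLinearResolution_iff_isLinear, map_bot]
  exact isLinear_bot e

theorem hasLinearResolution_top :
    HasLinearResolution (⊤ : Ideal (MvPolynomial (Fin n) k)) 0 := by
  rw [hasLinearResolution_iff_isLinear, map_top]
  exact isLinear_top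

theorem HasLinearResolution.span_singleton_mul (hI : HasLinearResolution I e)
    {p : MvPolynomial (Fin n) k} (hp0 : p ≠ 0) {d : ℕ} (hp : p.IsHomogeneous d) :
    HasLinearResolution (Ideal.span {p} * I) (e + d) := by
  rw [hasLinearResolution_iff_isLinear] at hI ⊢
  have hmap : rankOne (Ideal.span {p} * I) = (rankOne I).map (p • LinearMap.id) := by
    ext v
    rw [mem_rankOne, Ideal.mem_span_singleton_mul]
    constructor
    · rintro ⟨q, hq, hqv⟩
      exact ⟨fun _ => q, mem_rankOne.2 hq, funext fun _ => hqv⟩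
    · rintro ⟨u, hu, rfl⟩
      exact ⟨u (), mem_rankOne.1 hu, rfl⟩
  rw [hmap]
  refine hI.map (fun a v hv i => ?_) ?_
  · rw [add_comm]
    exact hp.mul (hv i)
  · exact LinearMap.ker_eq_bot.2 (smul_right_injective _ hp0)

theorem hasLinearResolution_span_singleton {p : MvPolynomial (Fin n) k} (hp0 : p ≠ 0) {d : ℕ}
    (hp : p.IsHomogeneous d) : HasLinearResolution (Ideal.span {p}) d := by
  simpa only [Ideal.mul_top, zero_add] using hasLinearResolution_top.span_singleton_mul hp0 hp

theorem HasLinearResolution.add (hA : HasLinearResolution A e) (hB : HasLinearResolution B e)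
    (hAB : HasLinearResolution (A ⊓ B) (e + 1)) : HasLinearResolution (A + B) e := by
  rw [hasLinearResolution_iff_isLinear] at hA hB hAB ⊢
  rw [Submodule.add_eq_sup, map_sup]
  rw [map_inf] at hAB
  exact hA.sup hB hAB

theorem HasLinearResolution.add_iff_inf (hA : HasLinearResolution A e)
    (hB : HasLinearResolution B e) (hAB : ∀ p ∈ A ⊓ B, p.IsHomogeneous e → p = 0) :
    HasLinearResolution (A + B) e ↔ HasLinearResolution (A ⊓ B) (e + 1) := by
  refine ⟨fun h => ?_, hA.add hB⟩
  rw [hasLinearResolution_iff_isLinear] at hA hB h ⊢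
  rw [Submodule.add_eq_sup, map_sup] at h
  rw [map_inf]
  refine hA.inf (homogeneousSubmodule_zero (Fin n)).le hB h fun v hv hve => ?_
  rw [← map_inf, mem_rankOne] at hv
  exact funext fun _ => hAB _ hv (hve ())

end Ideals

theorem add_single_le {ι : Type*} {u a : ι →₀ ℕ} (hua : u ≤ a) {i : ι} (hi : u i < a i) :
    u + Finsupp.single i 1 ≤ a := by
  rw [← add_tsub_cancel_of_le hua]
  refine add_le_add_right (Finsupp.single_le_iff.2 ?_) u
  exact Nat.sub_pos_of_lt hi

section MonomialIdeals

open MvPolynomial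

variable {k : Type*} [Field k] {n : ℕ} {A B : Set (Fin n →₀ ℕ)} {e : ℕ}

theorem mem_monomialIdeal {p : MvPolynomial (Fin n) k} :
    p ∈ monomialIdeal k A ↔ ∀ a ∈ p.support, a ∈ upperClosure A :=
  mem_ideal_span_monomial_image

variable (k A B) in
theorem monomialIdeal_inf_monomialIdeal :
    monomialIdeal k A ⊓ monomialIdeal k B =
      monomialIdeal k ((upperClosure A ⊔ upperClosure B : UpperSet (Fin n →₀ ℕ)) : Set _) := by
  ext p
  simp only [Ideal.mem_inf, mem_monomialIdeal, UpperSet.upperClosure, UpperSet.mem_sup_iff,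
    ← forall_and]

variable (k) in
theorem monomialIdeal_congr (h : upperClosure A = upperClosure B) :
    monomialIdeal k A = monomialIdeal k B := by
  ext p
  rw [mem_monomialIdeal, mem_monomialIdeal, h]

variable (k A B) in
theorem monomialIdeal_union :
    monomialIdeal k (A ∪ B) = monomialIdeal k A + monomialIdeal k B := by
  rw [monomialIdeal, Set.image_union, Ideal.span_union]
  rfl

variable (k A) in
theorem span_monomial_mul_monomialIdeal (u : Fin n →₀ ℕ) :
    Ideal.span {monomial u (1 : k)} * monomialIdeal k A = monomialIdeal k ((u + ·) '' A) := by
  simp only [monomialIdeal, Ideal.span_mul_span', Set.singleton_mul, Set.image_image, monomial_mul,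
    mul_one]

theorem hasLinearResolution_monomialIdeal_singleton {u : Fin n →₀ ℕ} (hu : u.degree = e) :
    HasLinearResolution (monomialIdeal k {u}) e := by
  rw [monomialIdeal, Set.image_singleton]
  exact hasLinearResolution_span_singleton (monomial_eq_zero.not.2 one_ne_zero)
    (isHomogeneous_monomial _ hu)

theorem eq_zero_of_mem_monomialIdeal (hA : ∀ a ∈ A, e < a.degree) {p : MvPolynomial (Fin n) k}
    (hp : p ∈ monomialIdeal k A) (hpe : p.IsHomogeneous e) : p = 0 := by
  rw [← support_eq_empty, Finset.eq_empty_iff_forall_notMem]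
  intro a ha
  obtain ⟨v, hv, hva⟩ := mem_monomialIdeal.1 hp a ha
  have hae : a.degree = e := not_imp_comm.1 hpe.coeff_eq_zero (mem_support_iff.1 ha)
  exact ((hA v hv).trans_le (Finsupp.degree_mono hva)).ne' hae

theorem generatedInDegree_monomialIdeal_iff (D : UpperSet (Fin n →₀ ℕ)) :
    GeneratedInDegree (monomialIdeal k (D : Set (Fin n →₀ ℕ))) e ↔
      monomialIdeal k (D : Set (Fin n →₀ ℕ)) = monomialIdeal k {a | a ∈ D ∧ a.degree = e} := by
  constructor
  · rintro ⟨G, hG, hGD⟩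
    refine le_antisymm ?_ (Ideal.span_mono (Set.image_mono fun a ha => ha.1))
    rw [← hGD, Ideal.span_le]
    refine fun p hp => mem_monomialIdeal.2 fun a ha => subset_upperClosure ⟨?_, ?_⟩
    · rw [← D.upperClosure]
      exact mem_monomialIdeal.1 (hGD ▸ Ideal.subset_span hp) a ha
    · exact not_imp_comm.1 (hG p hp).coeff_eq_zero (mem_support_iff.1 ha)
  · refine fun h => ⟨_, ?_, h.symm⟩
    rintro _ ⟨a, ha, rfl⟩
    exact isHomogeneous_monomial _ ha.2

/-- `T` consists of the variables generating the colon ideal `(A) : u`. -/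
theorem HasLinearResolution.monomialIdeal_insert {u : Fin n →₀ ℕ} {T : Set (Fin n)}
    (hA : HasLinearResolution (monomialIdeal k A) e) (hu : u.degree = e)
    (hT : HasLinearResolution (monomialIdeal k ((Finsupp.single · 1) '' T)) 1)
    (hTA : ∀ j ∈ T, u + Finsupp.single j 1 ∈ upperClosure A)
    (hAT : ∀ v ∈ A, ∃ j ∈ T, u j < v j) :
    HasLinearResolution (monomialIdeal k (insert u A)) e := by
  rw [← Set.union_singleton, monomialIdeal_union]
  refine hA.add (hasLinearResolution_monomialIdeal_singleton hu) ?_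
  have hcolon : monomialIdeal k A ⊓ monomialIdeal k {u} =
      Ideal.span {monomial u (1 : k)} * monomialIdeal k ((Finsupp.single · 1) '' T) := by
    rw [span_monomial_mul_monomialIdeal, monomialIdeal_inf_monomialIdeal, Set.image_image]
    refine monomialIdeal_congr k (UpperSet.ext ?_)
    rw [UpperSet.upperClosure]
    ext a
    constructor
    · rintro ⟨⟨v, hv, hva⟩, u, rfl, hua⟩
      obtain ⟨j, hj, hjv⟩ := hAT v hv
      exact ⟨_, ⟨j, hj, rfl⟩, add_single_le hua (hjv.trans_le (hva j))⟩
    · rintro ⟨_, ⟨j, hj, rfl⟩, hja⟩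
      exact ⟨(upperClosure A).upper hja (hTA j hj), u, rfl, le_self_add.trans hja⟩
  rw [hcolon, add_comm]
  exact hT.span_singleton_mul (monomial_eq_zero.not.2 one_ne_zero) (isHomogeneous_monomial _ hu)

theorem hasLinearResolution_monomialIdeal_image_single (T : Set (Fin n)) :
    HasLinearResolution (monomialIdeal k ((Finsupp.single · 1) '' T)) 1 := by
  induction T, T.toFinite using Set.Finite.induction_on with
  | empty =>
    rw [monomialIdeal, Set.image_empty, Set.image_empty, Ideal.span_empty]
    exact hasLinearResolution_bot 1
  | @insert j T hj _ ih =>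
    rw [Set.image_insert_eq]
    refine ih.monomialIdeal_insert (Finsupp.degree_single j 1) ih
      (fun i hi => ⟨_, Set.mem_image_of_mem _ hi, le_add_self⟩) ?_
    rintro _ ⟨i, hi, rfl⟩
    refine ⟨i, hi, ?_⟩
    rw [Finsupp.single_eq_of_ne (ne_of_mem_of_not_mem hi hj), Finsupp.single_eq_same]
    exact one_pos

theorem hasLinearResolution_of_linearQuotients {α : Type*} [LinearOrder α]
    (key : (Fin n →₀ ℕ) → α) (hA : ∀ a ∈ A, a.degree = e)
    (h : ∀ u ∈ A, ∀ v ∈ A, v ≠ u → key v ≤ key u →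
      ∃ j, u j < v j ∧ ∃ v' ∈ A, key v' < key u ∧ v' ≤ u + Finsupp.single j 1) :
    HasLinearResolution (monomialIdeal k A) e := by
  obtain ⟨A, rfl⟩ := ((Finsupp.finite_of_degree_eq e).subset hA).exists_finset_coe
  simp only [Finset.mem_coe] at hA h
  classical
  induction A using Finset.induction_on_max_value key with
  | empty =>
    rw [monomialIdeal, Finset.coe_empty, Set.image_empty, Ideal.span_empty]
    exact hasLinearResolution_bot e
  | insert u A hu hmax ih =>
    have hA' : ∀ a ∈ A, a.degree = e := fun a ha => hA a (Finset.mem_insert_of_mem ha)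
    have hmem : ∀ v' ∈ insert u A, key v' < key u → v' ∈ A := fun v' hv' hlt =>
      Finset.mem_of_mem_insert_of_ne hv' fun h => hlt.ne (congrArg key h)
    have hq : HasLinearResolution (monomialIdeal k (A : Set (Fin n →₀ ℕ))) e := by
      refine ih hA' fun a ha v hv hva hle => ?_
      obtain ⟨j, hj, v', hv', hlt, hv'a⟩ :=
        h a (Finset.mem_insert_of_mem ha) v (Finset.mem_insert_of_mem hv) hva hle
      exact ⟨j, hj, v', hmem v' hv' (hlt.trans_le (hmax a ha)), hlt, hv'a⟩
    rw [Finset.coe_insert]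
    refine hq.monomialIdeal_insert (hA u (Finset.mem_insert_self u A))
      (hasLinearResolution_monomialIdeal_image_single
        {j | u + Finsupp.single j 1 ∈ upperClosure (A : Set (Fin n →₀ ℕ))})
      (fun _ hj => hj) fun v hv => ?_
    obtain ⟨j, hj, v', hv', hlt, hv'u⟩ := h u (Finset.mem_insert_self u A) v
      (Finset.mem_insert_of_mem hv) (ne_of_mem_of_not_mem hv hu) (hmax v hv)
    exact ⟨j, ⟨v', hmem v' hv' hlt, hv'u⟩, hj⟩

end MonomialIdeals

section Lex

variable {n : ℕ}

theorem eq_of_le_of_degree_eq {ι : Type*} {u v : ι →₀ ℕ} (h : u ≤ v) (hd : u.degree = v.degree) :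
    u = v := by
  obtain ⟨t, rfl⟩ := exists_add_of_le h
  rw [map_add, left_eq_add, Finsupp.degree_eq_zero_iff] at hd
  rw [hd, add_zero]

theorem toLex_lt_of_forall_lt_eq {u v : Fin n →₀ ℕ} {i : Fin n} (h : ∀ l < i, u l = v l)
    (hi : u i < v i) : toLex u < toLex v :=
  Finsupp.Lex.lt_iff.2 ⟨i, h, hi⟩

theorem exists_lt_lt_of_toLex_lt {u v : Fin n →₀ ℕ} (hd : u.degree = v.degree)
    (h : toLex u < toLex v) :
    ∃ i j, i < j ∧ (∀ l < i, u l = v l) ∧ u i < v i ∧ v j < u j := by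
  obtain ⟨i, hli, hi⟩ := Finsupp.Lex.lt_iff.1 h
  simp only [ofLex_toLex] at hli hi
  have hj : ∃ j, v j < u j := by
    by_contra! hle
    exact h.ne (congrArg toLex (eq_of_le_of_degree_eq hle hd))
  obtain ⟨j, hj⟩ := hj
  refine ⟨i, j, lt_of_not_ge fun hji => ?_, hli, hi, hj⟩
  obtain rfl | hji := hji.eq_or_lt
  · exact hi.not_gt hj
  · exact hj.ne' (hli j hji)

theorem toLex_lt_of_add_single_eq {u v : Fin n →₀ ℕ} {i j : Fin n} (hij : i < j)
    (h : v + Finsupp.single j 1 = u + Finsupp.single i 1) : toLex u < toLex v := by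
  refine lt_of_add_lt_add_right (a := toLex (Finsupp.single j 1)) ?_
  rw [← toLex_add v, h, toLex_add]
  exact add_lt_add_right (Finsupp.Lex.single_lt_iff.2 hij) _

theorem apply_zero_le_of_toLex_le [NeZero n] {u v : Fin n →₀ ℕ} (h : toLex u ≤ toLex v) :
    u 0 ≤ v 0 := by
  by_contra! hlt
  exact h.not_gt (toLex_lt_of_forall_lt_eq (fun l hl => absurd hl (Fin.not_lt_zero l)) hlt)

end Lex

section SquarefreeMonomials

variable {n d : ℕ} {u v : Fin n →₀ ℕ} {i j : Fin n}

theorem add_single_mem_sqfreeMon (hu : u ∈ sqfreeMon n d) (hi : u i = 0) :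
    u + Finsupp.single i 1 ∈ sqfreeMon n (d + 1) := by
  refine ⟨fun l => ?_, by rw [map_add, hu.2, Finsupp.degree_single]⟩
  obtain rfl | hl := eq_or_ne l i
  · rw [Finsupp.add_apply, hi, Finsupp.single_eq_same]
  · rw [Finsupp.add_apply, Finsupp.single_eq_of_ne hl]
    exact hu.1 l

theorem sub_single_mem_sqfreeMon (hu : u ∈ sqfreeMon n (d + 1)) (hi : u i ≠ 0) :
    u - Finsupp.single i 1 ∈ sqfreeMon n d := by
  refine ⟨fun l => (Nat.sub_le _ _).trans (hu.1 l), ?_⟩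
  have h := congrArg Finsupp.degree (Finsupp.sub_add_single_one_cancel hi)
  rw [map_add, Finsupp.degree_single, hu.2] at h
  exact Nat.succ_injective h

theorem exists_mem_sqfreeMon_add_single_eq (hu : u ∈ sqfreeMon n d) (hi : u i = 0) (hj : u j ≠ 0) :
    ∃ v ∈ sqfreeMon n d, v + Finsupp.single j 1 = u + Finsupp.single i 1 := by
  have hj' : (u + Finsupp.single i 1 : Fin n →₀ ℕ) j ≠ 0 :=
    (Nat.add_pos_left (Nat.pos_of_ne_zero hj) _).ne'
  exact ⟨_, sub_single_mem_sqfreeMon (add_single_mem_sqfreeMon hu hi) hj',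
    Finsupp.sub_add_single_one_cancel hj'⟩

theorem exists_isGreatest_notMem_support (hu : ∀ l, u l ≤ 1) (hd : u.degree = v.degree)
    (huv : u ≠ v) : ∃ M, IsGreatest {l | l ∉ v.support} M := by
  have hne : v.supportᶜ.Nonempty := by
    by_contra! h
    refine huv (eq_of_le_of_degree_eq (fun l => (hu l).trans ?_) hd)
    exact Nat.one_le_iff_ne_zero.2 (Finsupp.mem_support_iff.1
      (Finset.compl_eq_empty_iff _ |>.1 h ▸ Finset.mem_univ l))
  have hmax := v.supportᶜ.isGreatest_max' hne
  rw [Finset.coe_compl] at hmax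
  exact ⟨_, hmax⟩

end SquarefreeMonomials

section Segments

variable {k : Type*} [Field k] {n d : ℕ} {w m a : Fin n →₀ ℕ}

variable (k d w) in
theorem hasLinearResolution_initialSegment :
    HasLinearResolution (monomialIdeal k (initialSegment d w)) d := by
  refine hasLinearResolution_of_linearQuotients (fun u => OrderDual.toDual (toLex u))
    (fun a ha => ha.1.2) fun u hu v hv hvu hle => ?_
  have huv : toLex u < toLex v := lt_of_le_of_ne hle (toLex.injective.ne hvu.symm)
  obtain ⟨i, j, hij, -, hi, hj⟩ := exists_lt_lt_of_toLex_lt (hu.1.2.trans hv.1.2.symm) huv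
  obtain ⟨v', hv', h⟩ := exists_mem_sqfreeMon_add_single_eq hu.1
    (Nat.lt_one_iff.1 (hi.trans_le (hv.1.1 i))) (Nat.ne_zero_of_lt hj)
  have huv' : toLex u < toLex v' := toLex_lt_of_add_single_eq hij h
  exact ⟨i, hi, v', ⟨hv', hu.2.trans huv'.le⟩, huv', le_self_add.trans h.le⟩

variable (k d m) in
theorem hasLinearResolution_finalSegment :
    HasLinearResolution (monomialIdeal k (finalSegment d m)) d := by
  refine hasLinearResolution_of_linearQuotients toLex
    (fun a ha => ha.1.2) fun u hu v hv hvu hle => ?_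
  have hlt : toLex v < toLex u := lt_of_le_of_ne hle (toLex.injective.ne hvu)
  obtain ⟨i, j, hij, -, hi, hj⟩ := exists_lt_lt_of_toLex_lt (hv.1.2.trans hu.1.2.symm) hlt
  obtain ⟨v', hv', h⟩ := exists_mem_sqfreeMon_add_single_eq hu.1
    (Nat.lt_one_iff.1 (hj.trans_le (hv.1.1 j))) (Nat.ne_zero_of_lt hi)
  have hv'u : toLex v' < toLex u := toLex_lt_of_add_single_eq hij h.symm
  exact ⟨j, hj, v', ⟨hv', hv'u.le.trans hu.2⟩, hv'u, le_self_add.trans h.le⟩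

theorem toLex_add_single_le (hw : w.degree = d) (ha : a ∈ sqfreeMon n (d + 1)) {M : Fin n}
    (hM : M ∈ upperBounds {i | i ∉ w.support}) (hwa : toLex w ≤ toLex a) :
    toLex (w + Finsupp.single M 1) ≤ toLex a := by
  by_contra! hlt
  have hdeg : a.degree = (w + Finsupp.single M 1).degree := by
    rw [map_add, Finsupp.degree_single, ha.2, hw]
  obtain ⟨i, j, hij, hli, hi, hj⟩ := exists_lt_lt_of_toLex_lt hdeg hlt
  have hwMj : w j + Finsupp.single M 1 j = 0 := Nat.lt_one_iff.1 (hj.trans_le (ha.1 j))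
  obtain ⟨hwj, hMj⟩ := add_eq_zero.1 hwMj
  have hiM : i < M := hij.trans_le (hM (Finsupp.notMem_support_iff.2 hwj))
  have happly : ∀ l ≤ i, (w + Finsupp.single M 1 : Fin n →₀ ℕ) l = w l := fun l hl => by
    rw [Finsupp.add_apply, Finsupp.single_eq_of_ne (hl.trans_lt hiM).ne, add_zero]
  rw [happly i le_rfl] at hi
  exact hwa.not_gt (toLex_lt_of_forall_lt_eq (fun l hl => (hli l hl).trans (happly l hl.le)) hi)

theorem toLex_le_sub_single (hw : w.degree = d) (ha : a ∈ sqfreeMon n (d + 1)) {t : Fin n}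
    (ht : IsGreatest {i | i ∈ a.support} t) (hwa : toLex w ≤ toLex a) :
    toLex w ≤ toLex (a - Finsupp.single t 1) := by
  by_contra! hlt
  have hdeg : (a - Finsupp.single t 1).degree = w.degree :=
    (sub_single_mem_sqfreeMon ha (Finsupp.mem_support_iff.1 ht.1)).2.trans hw.symm
  obtain ⟨i, j, hij, hli, hi, hj⟩ := exists_lt_lt_of_toLex_lt hdeg hlt
  have hja : j ∈ a.support :=
    Finsupp.mem_support_iff.2 (Nat.ne_zero_of_lt (hj.trans_le (Nat.sub_le _ _)))
  have hit : i < t := hij.trans_le (ht.2 hja)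
  have happly : ∀ l ≤ i, (a - Finsupp.single t 1 : Fin n →₀ ℕ) l = a l := fun l hl => by
    rw [Finsupp.tsub_apply, Finsupp.single_eq_of_ne (hl.trans_lt hit).ne, tsub_zero]
  rw [happly i le_rfl] at hi
  exact hwa.not_gt
    (toLex_lt_of_forall_lt_eq (fun l hl => (happly l hl.le).symm.trans (hli l hl)) hi)

theorem mem_upperClosure_initialSegment_iff (hw : w.degree = d) {M : Fin n}
    (hM : M ∈ upperBounds {i | i ∉ w.support}) (ha : a ∈ sqfreeMon n (d + 1)) :
    a ∈ upperClosure (initialSegment d w) ↔ toLex (w + Finsupp.single M 1) ≤ toLex a := by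
  constructor
  · rintro ⟨v, hv, hva⟩
    exact toLex_add_single_le hw ha hM (hv.2.trans (Finsupp.toLex_monotone hva))
  · intro hwa
    have hne : a.support.Nonempty := by
      rw [Finsupp.support_nonempty_iff]
      rintro rfl
      exact absurd ha.2 (Nat.succ_ne_zero d).symm
    have ht := a.support.isGreatest_max' hne
    refine ⟨_, ⟨sub_single_mem_sqfreeMon ha (Finsupp.mem_support_iff.1 ht.1), ?_⟩, tsub_le_self⟩
    exact toLex_le_sub_single hw ha ht ((Finsupp.toLex_monotone le_self_add).trans hwa)

section FirstVariable

variable [NeZero n]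

theorem exists_mem_finalSegment_single_add_le (hw0 : w 0 ≠ 0) (hm0 : m 0 = 0)
    (hwa : a ∈ upperClosure (initialSegment d w)) (hma : a ∈ upperClosure (finalSegment d m)) :
    ∃ v ∈ finalSegment d m, v 0 = 0 ∧ v + Finsupp.single 0 1 ≤ a := by
  obtain ⟨u, hu, hua⟩ := hwa
  obtain ⟨v, hv, hva⟩ := hma
  have hv0 : v 0 = 0 := Nat.le_zero.1 (hm0 ▸ apply_zero_le_of_toLex_le hv.2)
  have ha0 : 0 < a 0 :=
    (Nat.pos_of_ne_zero hw0).trans_le ((apply_zero_le_of_toLex_le hu.2).trans (hua 0))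
  exact ⟨v, hv, hv0, add_single_le hva (hv0 ▸ ha0)⟩

theorem lt_degree_of_mem_upperClosure (hw0 : w 0 ≠ 0) (hm0 : m 0 = 0)
    (ha : a ∈ upperClosure (initialSegment d w) ⊔ upperClosure (finalSegment d m)) :
    d < a.degree := by
  obtain ⟨v, hv, -, hva⟩ := exists_mem_finalSegment_single_add_le hw0 hm0 ha.1 ha.2
  have hle := Finsupp.degree_mono hva
  rwa [map_add, Finsupp.degree_single, hv.1.2] at hle

theorem setOf_degree_eq_lexSegment (hw : w.degree = d) (hw0 : w 0 ≠ 0) (hm0 : m 0 = 0)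
    {M : Fin n} (hM : M ∈ upperBounds {i | i ∉ w.support}) :
    {a | a ∈ upperClosure (initialSegment d w) ⊔ upperClosure (finalSegment d m) ∧
      a.degree = d + 1} =
      lexSegment (d + 1) (Finsupp.single 0 1 + m) (w + Finsupp.single M 1) := by
  ext a
  constructor
  · rintro ⟨⟨hwa, hma⟩, hd⟩
    obtain ⟨v, hv, hv0, hva⟩ := exists_mem_finalSegment_single_add_le hw0 hm0 hwa hma
    have hv' := add_single_mem_sqfreeMon hv.1 hv0
    obtain rfl := eq_of_le_of_degree_eq hva (hv'.2.trans hd.symm)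
    refine ⟨hv', ?_, (mem_upperClosure_initialSegment_iff hw hM hv').1 hwa⟩
    rw [add_comm]
    exact add_le_add_right hv.2 _
  · rintro ⟨ha, ham, hwa⟩
    have ha0 : a 0 ≠ 0 :=
      (((Nat.pos_of_ne_zero hw0).trans_le (Nat.le_add_right _ _)).trans_le
        (apply_zero_le_of_toLex_le hwa)).ne'
    refine ⟨⟨(mem_upperClosure_initialSegment_iff hw hM ha).2 hwa, a - Finsupp.single 0 1,
      ⟨sub_single_mem_sqfreeMon ha ha0, ?_⟩, tsub_le_self⟩, ha.2⟩
    refine le_of_add_le_add_left (a := toLex (Finsupp.single 0 1)) (ham.trans' ?_)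
    rw [← toLex_add, add_comm, Finsupp.sub_add_single_one_cancel ha0]

end FirstVariable

end Segments

end SquarefreeLex

open SquarefreeLex

theorem mainTheorem9 {k : Type*} [Field k] {n : ℕ} [NeZero n] {d : ℕ} (w m : Fin n →₀ ℕ)
    (hw : w ∈ SquarefreeLex.sqfreeMon n d) (hm : m ∈ SquarefreeLex.sqfreeMon n d)
    (hw1 : (0 : Fin n) ∈ w.support) (hm1 : (0 : Fin n) ∉ m.support)
    (J K : Ideal (MvPolynomial (Fin n) k))
    (hJ : J = SquarefreeLex.monomialIdeal k (SquarefreeLex.initialSegment d w))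
    (hK : K = SquarefreeLex.monomialIdeal k (SquarefreeLex.finalSegment d m)) :
    (SquarefreeLex.HasLinearResolution (J + K) d ↔
      SquarefreeLex.HasLinearResolution (J ⊓ K) (d + 1)) ∧
    ∃ M : Fin n, IsGreatest {i : Fin n | i ∉ w.support} M ∧
      (SquarefreeLex.GeneratedInDegree (J ⊓ K) (d + 1) ↔
        J ⊓ K = SquarefreeLex.monomialIdeal k
          (SquarefreeLex.lexSegment (d + 1)
            (Finsupp.single 0 1 + m) (w + Finsupp.single M 1))) := by
  have hw0 : w 0 ≠ 0 := Finsupp.mem_support_iff.1 hw1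
  have hm0 : m 0 = 0 := Finsupp.notMem_support_iff.1 hm1
  obtain ⟨M, hM⟩ := exists_isGreatest_notMem_support hm.1 (hm.2.trans hw.2.symm)
    fun h => hm1 (h ▸ hw1)
  have hinf := monomialIdeal_inf_monomialIdeal k (initialSegment d w) (finalSegment d m)
  subst hJ hK
  refine ⟨(hasLinearResolution_initialSegment k d w).add_iff_inf
    (hasLinearResolution_finalSegment k d m) ?_, M, hM, ?_⟩
  · rw [hinf]
    exact fun p => eq_zero_of_mem_monomialIdeal fun a ha => lt_degree_of_mem_upperClosure hw0 hm0 ha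
  · rw [hinf, generatedInDegree_monomialIdeal_iff, setOf_degree_eq_lexSegment hw.2 hw0 hm0 hM.2]
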